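/- **Theorem (AT for Error in the Initial State, AT-Initial).** Let $E$ be a complex Hilbert space of finite or countably infinite dimension at least $2$. For $s\in[0,1]$ let $\mathcal H(s)$ be a (possibly unbounded) self-adjoint operator on $E$ with domain $\mathcal D$ independent of $s$, twice differentiable in $s$ on $[0,1]$ with bounded derivatives: there are bounded operators $\dot{\mathcal H}(s),\ddot{\mathcal H}(s)$ on $E$ such that $\frac{d}{ds}\mathcal H(s)x=\dot{\mathcal H}(s)x$ for $x\in\mathcal D$ and $\frac{d}{ds}\dot{\mathcal H}(s)x=\ddot{\mathcal H}(s)x$ for $x\in E$ (one-sided at the endpoints). Assume that for every $s\in[0,1]$ there is an orthonormal basis $|\psi_0(s)\rangle,|\psi_1(s)\rangle,\dots$ of $E$ consisting of eigenvectors of $\mathcal H(s)$ with eigenvalues $\lambda_0(s)\le\lambda_1(s)\le\cdots$. Let $\bar b_1,\bar b_2,\bar\gamma$ be constants such that for all $s\in[0,1]$ $$\|\dot{\mathcal H}(s)\|\le\bar b_1,\qquad \|\ddot{\mathcal H}(s)\|\le\bar b_2,\qquad \lambda_1(s)-\lambda_0(s)\ge\bar\gamma>0 .$$ Let $\tau>0$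 and let $U(s)$, $s\in[0,1]$, be the unitary evolution operators with $U(0)=I$ that solve $\dot U(s)=-i\tau\mathcal H(s)U(s)$; that is, for $x\in\mathcal D$, $U(s)x\in\mathcal D$ and $\frac{d}{ds}U(s)x=-i\tau\mathcal H(s)U(s)x$. Let $P(s)$ be the orthogonal projection onto the span of the ground state $|\psi_0(s)\rangle$ and $Q(s)=I-P(s)$. Let $$|\phi(0)\rangle=\eta\left(|\psi_0(0)\rangle+\delta|\phi_\perp\rangle\right),$$ where $\delta,\eta\in\mathbb C$, $|\phi_\perp\rangle$ is a unit vector orthogonal to $|\psi_0(0)\rangle$, and $|\eta|^{-2}=1+|\delta|^2$. Then for every $s\in[0,1]$ $$\big\|Q(s)U(s)|\phi(0)\rangle\big\|\le|\eta|\left(|\delta|+\frac{8}{\tau\bar\gamma^2}\left(2\bar b_1+s\,\bar b_2+s\,\frac{16\,\bar b_1^2}{\bar\gamma}\right)\right).$$ -/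

import Mathlib

open Set

noncomputable section

namespace Adiabatic

/-- Index set `{0, 1, 2, ...}` of the energy levels of a system of (finite or countably infinite)
dimension `N`: it is `{0, ..., N - 1}` if `N` is finite and all of `ℕ` if `N = ⊤`. -/
abbrev Level (N : ℕ∞) : Type := {j : ℕ // (j : ℕ∞) < N}

/-- The ground level, in a system with at least two levels. -/
def level0 {N : ℕ∞} (hN : 1 < N) : Level N := ⟨0, lt_trans (by simp) hN⟩

/-- The first excited level. -/
def level1 {N : ℕ∞} (hN : 1 < N) : Level N := ⟨1, by simpa using hN⟩

variable {E : Type*} [NormedAddCommGroup E] [InnerProductSpace ℂ E]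

/-- `lam 0 ≤ lam 1 ≤ ...` are the eigenvalues of the operator `A` with domain `D`, listed with
multiplicity, and the orthonormal (Hilbert) basis `ψ` consists of corresponding eigenstates. -/
structure IsOrderedEigenbasis {N : ℕ∞} {D : Submodule ℂ E} (A : D →ₗ[ℂ] E)
    (ψ : HilbertBasis (Level N) ℂ E) (lam : Level N → ℝ) : Prop where
  monotone : Monotone lam
  eigen : ∀ j, ∃ h : ψ j ∈ D, A ⟨ψ j, h⟩ = (lam j : ℂ) • ψ j

/-- A time-dependent Hamiltonian `H s`, `0 ≤ s ≤ 1`, possibly unbounded, with a common domain `D`: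
each `H s` is self-adjoint, and `s ↦ H s` is twice differentiable, its first and second
derivatives being the bounded operators `H' s` and `H'' s` (with `D = ⊤` this is a family of
bounded self-adjoint operators). The derivatives are taken pointwise, on each vector;
differentiability in operator norm is a special case. -/
structure IsTwiceDiffHamiltonian {D : Submodule ℂ E} [CompleteSpace E] (H : ℝ → D →ₗ[ℂ] E)
    (H' H'' : ℝ → E →L[ℂ] E) : Prop where
  selfAdjoint : ∀ s ∈ Icc (0 : ℝ) 1, IsSelfAdjoint (LinearPMap.mk D (H s))
  deriv_one : ∀ s ∈ Icc (0 : ℝ) 1, ∀ x : D,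
    HasDerivWithinAt (fun t => H t x) (H' s x) (Icc 0 1) s
  deriv_two : ∀ s ∈ Icc (0 : ℝ) 1, ∀ x : E,
    HasDerivWithinAt (fun t => H' t x) (H'' s x) (Icc 0 1) s

/-- `U s`, `0 ≤ s ≤ 1`, are the unitary evolution operators of `H` with time scale `τ`: the
solution of the Schrödinger equation `dU/ds = -i τ H(s) U(s)`, `U(0) = 1`, on the domain of `H`. -/
structure IsEvolution {D : Submodule ℂ E} (H : ℝ → D →ₗ[ℂ] E) (τ : ℝ)
    (U : ℝ → E ≃ₗᵢ[ℂ] E) : Prop where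
  initial : ∀ x, U 0 x = x
  schrodinger : ∀ s ∈ Icc (0 : ℝ) 1, ∀ x : D, ∃ h : U s (x : E) ∈ D,
    HasDerivWithinAt (fun t => U t (x : E)) ((-(Complex.I * (τ : ℂ))) • H s ⟨U s (x : E), h⟩)
      (Icc 0 1) s

/-- The orthogonal projection `P` onto the line spanned by `v`. -/
def projP (v : E) : E →L[ℂ] E := (Submodule.span ℂ {v}).starProjection

/-- The complementary projection `Q = I - P`. -/
def projQ (v : E) : E →L[ℂ] E := 1 - projP v

/-- The initial state `η (ψ₀ + δ φ⊥)`. -/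
def perturbedState (η δ : ℂ) (ψ₀ φperp : E) : E := η • (ψ₀ + δ • φperp)

end Adiabatic

end

/-! Let `l` be the ground energy, `P` its projection, `Q = 1 - P`, and `S = (H - l)⁻¹ Q` the reduced
resolvent, of norm at most `g = 1/γ`. Since `H` commutes with `P`, the Schrödinger equation does not
move the occupation `⟨φ, Pφ⟩`; only the motion of `P` does, and it contributes `-2 Re⟨φ, S H' P φ⟩`.
This is not small, but it oscillates: because `S (H - l) = Q`, it equals, up to the factor `-2/τ`,
the part of the derivative of `Im⟨φ, S² H' P φ⟩` that comes from the motion of `φ`. Subtracting this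
term gives `correctedOccupation`, whose derivative is of order `1/τ`. The derivative also carries a
factor `‖Qφ‖`, since the `P` component of the remainder pairs to a real number.

Integrating up to the time where `‖Qφ‖` attains its maximum `G` gives `G² ≤ G · O(1/τ)`, so the
leakage itself is `O(1/τ)`, as `norm_sub_le` states. The initial error costs at most `|δ|` more, by
linearity of the evolution and `‖Q‖ ≤ 1`.

As `H` may be unbounded, all derivatives are taken on vectors. Those of `P` and `S` come from the
exact difference identities `P_eq` and `S_eq`, in which only increments of `H - l` occur. -/

noncomputable section

namespace Adiabatic

variable {E : Type*} [NormedAddCommGroup E] [InnerProductSpace ℂ E]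

/-! ### Spectral lower bounds and the reduced resolvent. -/

/-- Quadratic form bound for a vector whose coordinates are rescaled by factors at least `m`. -/
theorem mul_norm_sq_le_re_inner_of_repr {ι : Type*} (b : HilbertBasis ι ℂ E) {μ : ι → ℝ}
    {m : ℝ} (hm : ∀ j, m ≤ μ j) {x y : E}
    (h : ∀ j, inner ℂ (b j) y = (μ j : ℂ) * inner ℂ (b j) x) :
    m * ‖x‖ ^ 2 ≤ (inner ℂ x y).re := by
  have e : ∀ j, (inner ℂ x (b j) * inner ℂ (b j) x).re = ‖inner ℂ (b j) x‖ ^ 2 := fun j => by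
    rw [← inner_conj_symm x (b j), ← Complex.normSq_eq_conj_mul_self, Complex.ofReal_re,
      Complex.normSq_eq_norm_sq]
  have h1 := (Complex.hasSum_re (b.hasSum_inner_mul_inner x x)).mul_left m
  have h2 := Complex.hasSum_re (b.hasSum_inner_mul_inner x y)
  have e1 : (inner ℂ x x).re = ‖x‖ ^ 2 := by
    rw [inner_self_eq_norm_sq_to_K]; norm_cast
  rw [e1] at h1
  refine hasSum_le (fun j => ?_) h1 h2
  have e3 : inner ℂ x (b j) * inner ℂ (b j) y
      = (μ j : ℂ) * (inner ℂ x (b j) * inner ℂ (b j) x) := by rw [h j]; ring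
  rw [e3, Complex.re_ofReal_mul, e j]
  exact mul_le_mul_of_nonneg_right (hm j) (by positivity)

/-- The lowest eigenvalue bounds the quadratic form from below. -/
theorem IsOrderedEigenbasis.mul_norm_sq_le_re_inner {N : ℕ∞} (hN : 1 < N) {D : Submodule ℂ E}
    {A : D →ₗ[ℂ] E} (hsymm : ∀ x y : D, inner ℂ (A x) (y : E) = inner ℂ (x : E) (A y))
    {ψ : HilbertBasis (Level N) ℂ E} {lam : Level N → ℝ} (hψ : IsOrderedEigenbasis A ψ lam)
    (x : D) : lam (level0 hN) * ‖(x : E)‖ ^ 2 ≤ (inner ℂ (x : E) (A x)).re := by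
  refine mul_norm_sq_le_re_inner_of_repr ψ (μ := lam)
    (fun j => hψ.monotone (Subtype.mk_le_mk.2 (Nat.zero_le _))) fun j => ?_
  obtain ⟨h, hj⟩ := hψ.eigen j
  rw [← hsymm ⟨ψ j, h⟩ x, hj, inner_smul_left]
  simp

/-- `P` is the projection onto an eigenspace of the symmetric operator `A`, with eigenvalue `l`,
and `S` is the corresponding reduced resolvent `(A - l)⁻¹ (1 - P)`, of norm at most `g`. -/
structure IsReducedResolvent {D : Submodule ℂ E} (A : D →ₗ[ℂ] E) (l g : ℝ)
    (P S : E →L[ℂ] E) : Prop where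
  P_mem : ∀ x, P x ∈ D
  S_mem : ∀ x, S x ∈ D
  symm : ∀ x y : D, inner ℂ (A x) (y : E) = inner ℂ (x : E) (A y)
  A_P : ∀ x, A ⟨P x, P_mem x⟩ = (l : ℂ) • P x
  A_S : ∀ x, A ⟨S x, S_mem x⟩ - (l : ℂ) • S x = x - P x
  P_A : ∀ y : D, P (A y - (l : ℂ) • (y : E)) = 0
  S_A : ∀ y : D, S (A y - (l : ℂ) • (y : E)) = y - P y
  P_P : ∀ x, P (P x) = P x
  P_S : ∀ x, P (S x) = 0
  S_P : ∀ x, S (P x) = 0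
  P_symm : ∀ x y, inner ℂ (P x) y = inner ℂ x (P y)
  S_symm : ∀ x y, inner ℂ (S x) y = inner ℂ x (S y)
  norm_P : ‖P‖ ≤ 1
  norm_S : ‖S‖ ≤ g

theorem symmetric_of_isSelfAdjoint [CompleteSpace E] {D : Submodule ℂ E} {A : D →ₗ[ℂ] E}
    (hA : IsSelfAdjoint (LinearPMap.mk D A)) (x y : D) :
    inner ℂ (A x) (y : E) = inner ℂ (x : E) (A y) := by
  have h := LinearPMap.adjoint_isFormalAdjoint hA.dense_domain
  rw [LinearPMap.isSelfAdjoint_def.1 hA] at h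
  exact h x y

/-- A bounded perturbation of a self-adjoint operator that is bounded below and has dense range
is onto. -/
theorem surjective_add_of_isSelfAdjoint [CompleteSpace E] {D : Submodule ℂ E} {A : D →ₗ[ℂ] E}
    (hA : IsSelfAdjoint (LinearPMap.mk D A)) (B : E →L[ℂ] E) {c : ℝ} (hc : 0 < c)
    (hbound : ∀ x : D, c * ‖(x : E)‖ ≤ ‖A x + B x‖)
    (hdense : DenseRange fun x : D => A x + B x) :
    Function.Surjective fun x : D => A x + B x := by
  have hcl : IsClosed ((LinearPMap.mk D A).graph : Set (E × E)) := hA.isClosed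
  have : CompleteSpace (LinearPMap.mk D A).graph := hcl.completeSpace_coe
  -- On the closed graph, `(x, A x) ↦ A x + B x` is bounded and bounded below, so its range is
  -- closed as well as dense.
  let T : (LinearPMap.mk D A).graph →L[ℂ] E :=
    (ContinuousLinearMap.snd ℂ E E + B.comp (ContinuousLinearMap.fst ℂ E E)).comp
      (LinearPMap.mk D A).graph.subtypeL
  have hT : ∀ p : (LinearPMap.mk D A).graph, ∃ x : D, (p : E × E) = ((x : E), A x) := by
    rintro ⟨p, hp⟩
    obtain ⟨x, hx⟩ := (LinearPMap.mem_graph_iff' _).1 hp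
    exact ⟨x, hx.symm⟩
  have hanti : AntilipschitzWith (Real.toNNReal (c⁻¹ + (1 + ‖B‖ * c⁻¹))) T := by
    refine AddMonoidHomClass.antilipschitz_of_bound T fun p => ?_
    obtain ⟨x, hx⟩ := hT p
    have hTp : T p = A x + B x := by
      change (p : E × E).2 + B (p : E × E).1 = _
      rw [hx]
    have hn : ‖p‖ = max ‖(x : E)‖ ‖A x‖ := by
      change ‖(p : E × E)‖ = _
      rw [hx, Prod.norm_def]
    rw [Real.coe_toNNReal _ (by positivity), hTp, hn]
    have h1 : ‖(x : E)‖ ≤ c⁻¹ * ‖A x + B x‖ := by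
      rw [le_inv_mul_iff₀ hc]; exact hbound x
    have h2 : ‖A x‖ ≤ (1 + ‖B‖ * c⁻¹) * ‖A x + B x‖ := by
      calc ‖A x‖ = ‖(A x + B x) - B x‖ := by simp
        _ ≤ ‖A x + B x‖ + ‖B‖ * ‖(x : E)‖ := (norm_sub_le _ _).trans (by gcongr; exact B.le_opNorm _)
        _ ≤ ‖A x + B x‖ + ‖B‖ * (c⁻¹ * ‖A x + B x‖) := by gcongr
        _ = _ := by ring
    have h3 : 0 ≤ c⁻¹ * ‖A x + B x‖ := by positivity
    have h4 : 0 ≤ (1 + ‖B‖ * c⁻¹) * ‖A x + B x‖ := by positivity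
    rw [add_mul]
    exact max_le (by linarith) (by linarith)
  have hrange : range T = range fun x : D => A x + B x := by
    ext y
    constructor
    · rintro ⟨p, rfl⟩
      obtain ⟨x, hx⟩ := hT p
      refine ⟨x, ?_⟩
      change _ = (p : E × E).2 + B (p : E × E).1
      rw [hx]
    · rintro ⟨x, rfl⟩
      exact ⟨⟨((x : E), A x), LinearPMap.mem_graph (LinearPMap.mk D A) x⟩, rfl⟩
  have hclosed := hanti.isClosed_range T.uniformContinuous
  rw [hrange] at hclosed
  rw [← Set.range_eq_univ, ← hclosed.closure_eq]
  exact hdense.closure_eq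

/-- A self-adjoint operator with an eigenbasis and a gap above a simple lowest eigenvalue has a
reduced resolvent at this eigenvalue. -/
theorem exists_isReducedResolvent [CompleteSpace E] {N : ℕ∞} (hN : 1 < N) {D : Submodule ℂ E}
    {A : D →ₗ[ℂ] E} (hA : IsSelfAdjoint (LinearPMap.mk D A)) {ψ : HilbertBasis (Level N) ℂ E}
    {lam : Level N → ℝ} (hψ : IsOrderedEigenbasis A ψ lam) {γ : ℝ} (hγ_pos : 0 < γ)
    (hγ : γ ≤ lam (level1 hN) - lam (level0 hN)) :
    ∃ S : E →L[ℂ] E,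
      IsReducedResolvent A (lam (level0 hN)) γ⁻¹ (projP (ψ (level0 hN))) S := by
  classical
  have hsymm := symmetric_of_isSelfAdjoint hA
  set v := ψ (level0 hN) with hv
  set l := lam (level0 hN) with hl
  have hv1 : ‖v‖ = 1 := ψ.orthonormal.1 _
  set P := projP v with hP
  have hPx : ∀ x, P x = inner ℂ v x • v := fun x =>
    Submodule.starProjection_unit_singleton ℂ hv1 x
  obtain ⟨hvD, hAv⟩ := hψ.eigen (level0 hN)
  change A ⟨v, hvD⟩ = (l : ℂ) • v at hAv
  have hPv : P v = v := by
    rw [hPx, inner_self_eq_norm_sq_to_K, hv1]; simp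
  have P_mem : ∀ x, P x ∈ D := fun x => by rw [hPx]; exact D.smul_mem _ hvD
  have A_P : ∀ x, A ⟨P x, P_mem x⟩ = (l : ℂ) • P x := fun x => by
    have : (⟨P x, P_mem x⟩ : D) = inner ℂ v x • ⟨v, hvD⟩ := Subtype.ext (hPx x)
    rw [this, map_smul, hAv, hPx, smul_comm]
  have P_symm : ∀ x y, inner ℂ (P x) y = inner ℂ x (P y) := fun x y =>
    Submodule.inner_starProjection_left_eq_right _ x y
  have P_P : ∀ x, P (P x) = P x := fun x => by rw [hPx x, map_smul, hPv]
  have P_A : ∀ y : D, P (A y - (l : ℂ) • (y : E)) = 0 := fun y => by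
    rw [hPx, inner_sub_right, ← hsymm ⟨v, hvD⟩ y, hAv, inner_smul_left, inner_smul_right]
    simp
  have norm_P : ‖P‖ ≤ 1 := Submodule.starProjection_norm_le _
  -- `A + B = A - l + γ P` has eigenvalue `γ` on the ground state and `lam j - l ≥ γ` elsewhere. It
  -- is therefore invertible, and its inverse restricted by `1 - P` is the reduced resolvent.
  let B : E →L[ℂ] E := (γ : ℂ) • P - (l : ℂ) • (1 : E →L[ℂ] E)
  have hB : ∀ x, B x = (γ : ℂ) • P x - (l : ℂ) • x := fun x => rfl
  let μ : Level N → ℝ := fun j => if j = level0 hN then γ else lam j - l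
  have hμ : ∀ j, γ ≤ μ j := fun j => by
    by_cases hj : j = level0 hN
    · simp [μ, hj]
    · simp only [μ, hj, if_false]
      have : level1 hN ≤ j := by
        obtain ⟨j, hj'⟩ := j
        have h0 : j ≠ 0 := fun h => hj (Subtype.ext h)
        exact Subtype.mk_le_mk.2 (Nat.one_le_iff_ne_zero.2 h0)
      linarith [hψ.monotone this]
  have hPψ : ∀ j, j ≠ level0 hN → P (ψ j) = 0 := fun j hj => by
    rw [hPx, hv, ψ.orthonormal.2 (Ne.symm hj), zero_smul]
  have hKψ : ∀ j, ∃ h : ψ j ∈ D, A ⟨ψ j, h⟩ + B (ψ j) = (μ j : ℂ) • ψ j := fun j => by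
    obtain ⟨h, hj⟩ := hψ.eigen j
    refine ⟨h, ?_⟩
    rw [hj, hB]
    by_cases hj0 : j = level0 hN
    · subst hj0
      rw [← hv, hPv]; simp [μ, hl]
    · rw [hPψ j hj0, show μ j = lam j - l from if_neg hj0, Complex.ofReal_sub, sub_smul, smul_zero,
        zero_sub, sub_eq_add_neg]
  have B_symm : ∀ x y, inner ℂ (B x) y = inner ℂ x (B y) := fun x y => by
    rw [hB, hB, inner_sub_left, inner_sub_right, inner_smul_left, inner_smul_left,
      inner_smul_right, inner_smul_right, P_symm]
    simp
  have hbound : ∀ x : D, γ * ‖(x : E)‖ ≤ ‖A x + B x‖ := fun x => by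
    have h1 : γ * ‖(x : E)‖ ^ 2 ≤ (inner ℂ (x : E) (A x + B x)).re := by
      refine mul_norm_sq_le_re_inner_of_repr ψ hμ fun j => ?_
      obtain ⟨h, hj⟩ := hKψ j
      rw [inner_add_right, ← B_symm, ← hsymm ⟨ψ j, h⟩ x, ← inner_add_left, hj, inner_smul_left]
      simp
    have h2 : (inner ℂ (x : E) (A x + B x)).re ≤ ‖(x : E)‖ * ‖A x + B x‖ :=
      (Complex.re_le_norm _).trans (norm_inner_le_norm _ _)
    rcases (norm_nonneg (x : E)).eq_or_lt with h0 | h0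
    · rw [← h0]; simp
    · refine le_of_mul_le_mul_left ?_ h0
      calc ‖(x : E)‖ * (γ * ‖(x : E)‖) = γ * ‖(x : E)‖ ^ 2 := by ring
        _ ≤ _ := h1.trans h2
  let K : D →ₗ[ℂ] E := A + B.toLinearMap ∘ₗ D.subtype
  have hK : ∀ x, K x = A x + B x := fun x => rfl
  have hdense : DenseRange fun x : D => A x + B x := by
    have hle : Submodule.span ℂ (range ψ) ≤ LinearMap.range K := by
      rw [Submodule.span_le]
      rintro _ ⟨j, rfl⟩
      obtain ⟨h, hj⟩ := hKψ j
      have hμ0 : (μ j : ℂ) ≠ 0 := by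
        exact_mod_cast (hγ_pos.trans_le (hμ j)).ne'
      refine ⟨(μ j : ℂ)⁻¹ • ⟨ψ j, h⟩, ?_⟩
      rw [map_smul, hK, hj, inv_smul_smul₀ hμ0]
    have := (Submodule.dense_iff_topologicalClosure_eq_top.2 ψ.dense_span).mono hle
    exact this
  have hsurj := surjective_add_of_isSelfAdjoint hA B hγ_pos hbound hdense
  have hinj : Function.Injective K := by
    rw [← LinearMap.ker_eq_bot, LinearMap.ker_eq_bot']
    intro x hx
    have := hbound x
    rw [← hK, hx, norm_zero] at this
    have h0 : ‖(x : E)‖ ≤ 0 := by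
      by_contra hc
      push Not at hc
      have := mul_pos hγ_pos hc
      linarith
    exact Subtype.ext (norm_le_zero_iff.1 h0)
  let e : D ≃ₗ[ℂ] E := LinearEquiv.ofBijective K ⟨hinj, hsurj⟩
  have hKe : ∀ y, A (e.symm y) + B (e.symm y) = y := fun y =>
    e.apply_symm_apply y
  have heK : ∀ x, e.symm (A x + B x) = x := fun x =>
    e.symm_apply_apply x
  have norm_Q : ∀ x, ‖x - P x‖ ≤ ‖x‖ := fun x => by
    have h0 : inner ℂ (x - P x) (P x) = 0 := by
      rw [← P_symm, map_sub, P_P, sub_self, inner_zero_left]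
    have h := norm_add_sq_eq_norm_sq_add_norm_sq_of_inner_eq_zero _ _ h0
    rw [sub_add_cancel] at h
    exact abs_le_of_sq_le_sq' (by nlinarith [norm_nonneg (P x)]) (norm_nonneg _) |>.2
  let S : E →L[ℂ] E :=
    LinearMap.mkContinuous (D.subtype ∘ₗ e.symm.toLinearMap ∘ₗ (1 - P : E →L[ℂ] E).toLinearMap) γ⁻¹
      (fun x => by
        rw [le_inv_mul_iff₀ hγ_pos]
        refine (hbound (e.symm (x - P x))).trans ?_
        rw [hKe]
        exact norm_Q x)
  have hS : ∀ x, S x = e.symm (x - P x) := fun x => rfl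
  have S_mem : ∀ x, S x ∈ D := fun x => (e.symm (x - P x)).2
  have hSx : ∀ x, (⟨S x, S_mem x⟩ : D) = e.symm (x - P x) := fun x => rfl
  have P_S : ∀ x, P (S x) = 0 := fun x => by
    have h := congrArg P (hKe (x - P x))
    have h2 := P_A (e.symm (x - P x))
    rw [hB, ← hS, add_sub_left_comm, map_add, ← hSx x] at h
    rw [← hSx x] at h2
    change P (A ⟨S x, S_mem x⟩ - (l : ℂ) • S x) = 0 at h2
    rw [h2, map_smul, P_P, map_sub, P_P, sub_self, add_zero] at h
    exact (smul_eq_zero.1 h).resolve_left (by exact_mod_cast hγ_pos.ne')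
  have A_S : ∀ x, A ⟨S x, S_mem x⟩ - (l : ℂ) • S x = x - P x := fun x => by
    have h := hKe (x - P x)
    rw [hB, ← hS, ← hSx x, P_S, smul_zero, zero_sub, ← sub_eq_add_neg] at h
    exact h
  have S_P : ∀ x, S (P x) = 0 := fun x => by
    rw [hS, P_P, sub_self, map_zero]; rfl
  refine ⟨S, P_mem, S_mem, hsymm, A_P, A_S, P_A, fun y => ?_, P_P, P_S, S_P, P_symm,
    fun x y => ?_, norm_P, LinearMap.mkContinuous_norm_le _ (by positivity) _⟩
  · rw [hS, P_A, sub_zero]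
    have h : A (y - ⟨P y, P_mem y⟩) + B ((y - ⟨P y, P_mem y⟩ : D) : E)
        = A y - (l : ℂ) • (y : E) := by
      rw [map_sub, A_P, hB]
      simp only [Submodule.coe_sub, map_sub, P_P, sub_self, smul_zero, smul_sub]
      abel
    rw [← h, heK]; rfl
  · have h1 : inner ℂ (S x) (P y) = 0 := by rw [← P_symm, P_S, inner_zero_left]
    have h2 : inner ℂ (P x) (S y) = 0 := by rw [P_symm, P_S, inner_zero_right]
    have h3 : inner ℂ (S x) (y - P y) = inner ℂ (x - P x) (S y) := by
      rw [← A_S, ← A_S, inner_sub_left, inner_sub_right, hsymm ⟨S x, S_mem x⟩ ⟨S y, S_mem y⟩,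
        inner_smul_left, inner_smul_right]
      simp
    rw [inner_sub_right, inner_sub_left, h1, h2, sub_zero, sub_zero] at h3
    exact h3

/-! ### Calculus of strongly differentiable operator families. -/

open Filter Topology

section StrongCalculus

variable {K : Set ℝ} {s : ℝ} {A : ℝ → E →L[ℂ] E} {C : ℝ}

theorem tendsto_clm_apply {f : Filter ℝ} (hC : ∀ᶠ t in f, ‖A t‖ ≤ C) {w : ℝ → E} {w₀ a : E}
    (hA : Tendsto (fun t => A t w₀) f (𝓝 a)) (hw : Tendsto w f (𝓝 w₀)) :
    Tendsto (fun t => A t (w t)) f (𝓝 a) := by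
  have h0 : Tendsto (fun t => A t (w t - w₀)) f (𝓝 0) := by
    have h1 : Tendsto (fun t => C * ‖w t - w₀‖) f (𝓝 0) := by
      simpa using (tendsto_iff_norm_sub_tendsto_zero.1 hw).const_mul C
    refine squeeze_zero_norm' ?_ h1
    filter_upwards [hC] with t ht
    exact (A t).le_of_opNorm_le ht _
  simpa using h0.add hA

/-- No differentiability of `A` is needed where the vector vanishes. -/
theorem hasDerivWithinAt_clm_apply_of_eq_zero (hC : ∀ t ∈ K, ‖A t‖ ≤ C) {w : ℝ → E}
    {w' : E} (hA : ContinuousWithinAt (fun t => A t w') K s) (hw0 : w s = 0)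
    (hw : HasDerivWithinAt w w' K s) :
    HasDerivWithinAt (fun t => A t (w t)) (A s w') K s := by
  rw [hasDerivWithinAt_iff_tendsto_slope] at hw ⊢
  have hle : 𝓝[K \ {s}] s ≤ 𝓝[K] s := nhdsWithin_mono _ sdiff_subset
  have h := tendsto_clm_apply ((eventually_mem_nhdsWithin.mono hC).filter_mono hle)
    (hA.mono_left hle) hw
  refine h.congr fun t => ?_
  simp [slope_def_module, hw0]

/-- The product rule for a bounded, pointwise differentiable family of operators. -/
theorem hasDerivWithinAt_clm_apply (hC : ∀ t ∈ K, ‖A t‖ ≤ C) {A' : E →L[ℂ] E}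
    (hA : ∀ x, HasDerivWithinAt (fun t => A t x) (A' x) K s) {w : ℝ → E} {w' : E}
    (hw : HasDerivWithinAt w w' K s) :
    HasDerivWithinAt (fun t => A t (w t)) (A' (w s) + A s w') K s := by
  have h1 := hasDerivWithinAt_clm_apply_of_eq_zero hC (hA w').continuousWithinAt
    (sub_self (w s)) (hw.sub_const (w s))
  refine ((hA (w s)).add h1).congr_of_eventuallyEq (.of_forall fun t => ?_) ?_ <;> simp

end StrongCalculus


/-! ### Differentiability of the eigenvalue, the projection and the reduced resolvent. -/

/-- A differentiable family of symmetric operators with bounded derivative `H'`, together with a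
Lipschitz continuous eigenvalue `l`, the projection `P` onto its eigenspace, and the reduced
resolvent `S`, all on the time interval `[0, 1]`. -/
structure IsAdiabaticFamily {D : Submodule ℂ E} (H : ℝ → D →ₗ[ℂ] E) (H' : ℝ → E →L[ℂ] E)
    (l : ℝ → ℝ) (P S : ℝ → E →L[ℂ] E) (b g : ℝ) : Prop where
  resolvent : ∀ s ∈ Icc (0 : ℝ) 1, IsReducedResolvent (H s) (l s) g (P s) (S s)
  deriv : ∀ s ∈ Icc (0 : ℝ) 1, ∀ x : D, HasDerivWithinAt (fun t => H t x) (H' s x) (Icc 0 1) s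
  norm_deriv : ∀ s ∈ Icc (0 : ℝ) 1, ‖H' s‖ ≤ b
  lipschitz : ∀ s ∈ Icc (0 : ℝ) 1, ∀ t ∈ Icc (0 : ℝ) 1, |l t - l s| ≤ b * |t - s|
  exists_unit : ∀ s ∈ Icc (0 : ℝ) 1, ∃ v, P s v = v ∧ ‖v‖ = 1

/-- The increment of `H - l` between the times `s` and `t`. -/
def increment {D : Submodule ℂ E} (H : ℝ → D →ₗ[ℂ] E) (l : ℝ → ℝ) (s t : ℝ) (y : D) : E :=
  H t y - H s y - ((l t - l s : ℝ) : ℂ) • (y : E)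

/-- The derivative of the projection, given the derivative `B` of `H - l`. -/
def projDeriv (B P S : E →L[ℂ] E) : E →L[ℂ] E := -(P ∘L B ∘L S) - S ∘L B ∘L P

/-- The derivative of the reduced resolvent, given the derivative `B` of `H - l`. -/
def resolventDeriv (B P S : E →L[ℂ] E) : E →L[ℂ] E :=
  -(S ∘L B ∘L S) + S ∘L S ∘L B ∘L P + P ∘L B ∘L S ∘L S

theorem norm_resolventDeriv_le {B P S : E →L[ℂ] E} {β g : ℝ} (hB : ‖B‖ ≤ β) (hP : ‖P‖ ≤ 1)
    (hS : ‖S‖ ≤ g) : ‖resolventDeriv B P S‖ ≤ 3 * β * g ^ 2 := by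
  have hg := (norm_nonneg _).trans hS
  have hβ := (norm_nonneg _).trans hB
  have h1 : ‖S ∘L B ∘L S‖ ≤ β * g ^ 2 := by
    calc ‖S ∘L B ∘L S‖ ≤ ‖S‖ * (‖B‖ * ‖S‖) := by
          grw [ContinuousLinearMap.opNorm_comp_le, ContinuousLinearMap.opNorm_comp_le]
      _ ≤ g * (β * g) := by gcongr
      _ = _ := by ring
  have h2 : ‖S ∘L S ∘L B ∘L P‖ ≤ β * g ^ 2 := by
    calc ‖S ∘L S ∘L B ∘L P‖ ≤ ‖S‖ * (‖S‖ * (‖B‖ * ‖P‖)) := by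
          grw [ContinuousLinearMap.opNorm_comp_le, ContinuousLinearMap.opNorm_comp_le,
            ContinuousLinearMap.opNorm_comp_le]
      _ ≤ g * (g * (β * 1)) := by gcongr
      _ = _ := by ring
  have h3 : ‖P ∘L B ∘L S ∘L S‖ ≤ β * g ^ 2 := by
    calc ‖P ∘L B ∘L S ∘L S‖ ≤ ‖P‖ * (‖B‖ * (‖S‖ * ‖S‖)) := by
          grw [ContinuousLinearMap.opNorm_comp_le, ContinuousLinearMap.opNorm_comp_le,
            ContinuousLinearMap.opNorm_comp_le]
      _ ≤ 1 * (β * (g * g)) := by gcongr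
      _ = _ := by ring
  have h := norm_add₃_le (a := -(S ∘L B ∘L S)) (b := S ∘L S ∘L B ∘L P) (c := P ∘L B ∘L S ∘L S)
  rw [norm_neg] at h
  unfold resolventDeriv
  linarith

theorem norm_projDeriv_le {B P S : E →L[ℂ] E} {β g : ℝ} (hB : ‖B‖ ≤ β) (hP : ‖P‖ ≤ 1)
    (hS : ‖S‖ ≤ g) : ‖projDeriv B P S‖ ≤ 2 * β * g := by
  have hg := (norm_nonneg _).trans hS
  have hβ := (norm_nonneg _).trans hB
  have h1 : ‖P ∘L B ∘L S‖ ≤ β * g := by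
    calc ‖P ∘L B ∘L S‖ ≤ ‖P‖ * (‖B‖ * ‖S‖) := by
          grw [ContinuousLinearMap.opNorm_comp_le, ContinuousLinearMap.opNorm_comp_le]
      _ ≤ 1 * (β * g) := by gcongr
      _ = _ := by ring
  have h2 : ‖S ∘L B ∘L P‖ ≤ β * g := by
    calc ‖S ∘L B ∘L P‖ ≤ ‖S‖ * (‖B‖ * ‖P‖) := by
          grw [ContinuousLinearMap.opNorm_comp_le, ContinuousLinearMap.opNorm_comp_le]
      _ ≤ g * (β * 1) := by gcongr
      _ = _ := by ring
  have h := norm_sub_le (-(P ∘L B ∘L S)) (S ∘L B ∘L P)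
  rw [norm_neg] at h
  unfold projDeriv
  linarith

namespace IsAdiabaticFamily

variable {D : Submodule ℂ E} {H : ℝ → D →ₗ[ℂ] E} {H' : ℝ → E →L[ℂ] E} {l : ℝ → ℝ}
  {P S : ℝ → E →L[ℂ] E} {b g s t : ℝ}

theorem P_increment (h : IsAdiabaticFamily H H' l P S b g) (ht : t ∈ Icc (0 : ℝ) 1) (y : D) :
    P t (increment H l s t y) = -P t (H s y - (l s : ℂ) • (y : E)) := by
  have e : increment H l s t y
      = (H t y - (l t : ℂ) • (y : E)) - (H s y - (l s : ℂ) • (y : E)) := by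
    simp only [increment, Complex.ofReal_sub, sub_smul]; abel
  rw [e, map_sub, (h.resolvent t ht).P_A, zero_sub]

theorem S_increment (h : IsAdiabaticFamily H H' l P S b g) (ht : t ∈ Icc (0 : ℝ) 1) (y : D) :
    S t (increment H l s t y) = y - P t y - S t (H s y - (l s : ℂ) • (y : E)) := by
  have e : increment H l s t y
      = (H t y - (l t : ℂ) • (y : E)) - (H s y - (l s : ℂ) • (y : E)) := by
    simp only [increment, Complex.ofReal_sub, sub_smul]; abel
  rw [e, map_sub, (h.resolvent t ht).S_A]

/-- With `Δ` the increment of `H - l`, this is `P t - P s = -P t Δ S s - S t Δ P s`, and `S_eq` is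
its analogue for `S`. Since `Δ` tends to `0` pointwise on `D`, the uniform bounds on `P t` and `S t`
give strong continuity. As `Δ` vanishes at `t = s`, strong continuity then suffices to differentiate
the right-hand side. -/
theorem P_eq (h : IsAdiabaticFamily H H' l P S b g) (hs : s ∈ Icc (0 : ℝ) 1)
    (ht : t ∈ Icc (0 : ℝ) 1) (x : E) :
    P t x = P s x + (-P t (increment H l s t ⟨S s x, (h.resolvent s hs).S_mem x⟩)
      - S t (increment H l s t ⟨P s x, (h.resolvent s hs).P_mem x⟩)) := by
  rw [h.P_increment ht, h.S_increment ht]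
  simp only [(h.resolvent s hs).A_S, (h.resolvent s hs).A_P, sub_self, map_sub, map_zero]
  abel

theorem S_eq (h : IsAdiabaticFamily H H' l P S b g) (hs : s ∈ Icc (0 : ℝ) 1)
    (ht : t ∈ Icc (0 : ℝ) 1) (x : E) :
    S t x = S s x + (-S t (increment H l s t ⟨S s x, (h.resolvent s hs).S_mem x⟩)
      + S t (S t (increment H l s t ⟨P s x, (h.resolvent s hs).P_mem x⟩))
      + P t (increment H l s t ⟨S s (S s x), (h.resolvent s hs).S_mem _⟩)) := by
  rw [h.P_increment ht, h.S_increment ht, h.S_increment ht]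
  simp only [(h.resolvent s hs).A_S, (h.resolvent s hs).A_P, sub_self, map_sub, map_zero,
    (h.resolvent t ht).S_P, (h.resolvent s hs).P_S]
  abel

theorem increment_self (y : D) : increment H l s s y = 0 := by simp [increment]

theorem continuousWithinAt_l (h : IsAdiabaticFamily H H' l P S b g) (hs : s ∈ Icc (0 : ℝ) 1) :
    ContinuousWithinAt l (Icc 0 1) s := by
  refine tendsto_iff_norm_sub_tendsto_zero.2 ?_
  have h0 : Tendsto (fun t => b * |t - s|) (𝓝[Icc 0 1] s) (𝓝 0) := by
    have : Continuous fun t => b * |t - s| := by fun_prop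
    simpa using (this.tendsto s).mono_left nhdsWithin_le_nhds
  refine squeeze_zero' (.of_forall fun t => norm_nonneg _) ?_ h0
  filter_upwards [self_mem_nhdsWithin] with t ht
  exact h.lipschitz s hs t ht

theorem continuousWithinAt_increment (h : IsAdiabaticFamily H H' l P S b g)
    (hs : s ∈ Icc (0 : ℝ) 1) (y : D) :
    ContinuousWithinAt (fun t => increment H l s t y) (Icc 0 1) s := by
  refine ((h.deriv s hs y).continuousWithinAt.sub continuousWithinAt_const).sub ?_
  refine ContinuousWithinAt.smul ?_ continuousWithinAt_const
  exact Complex.continuous_ofReal.continuousAt.comp_continuousWithinAt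
    ((h.continuousWithinAt_l hs).sub continuousWithinAt_const)

theorem norm_P (h : IsAdiabaticFamily H H' l P S b g) : ∀ t ∈ Icc (0 : ℝ) 1, ‖P t‖ ≤ 1 :=
  fun t ht => (h.resolvent t ht).norm_P

theorem norm_S (h : IsAdiabaticFamily H H' l P S b g) : ∀ t ∈ Icc (0 : ℝ) 1, ‖S t‖ ≤ g :=
  fun t ht => (h.resolvent t ht).norm_S

theorem tendsto_clm_increment (h : IsAdiabaticFamily H H' l P S b g) (hs : s ∈ Icc (0 : ℝ) 1)
    {A : ℝ → E →L[ℂ] E} {C : ℝ} (hC : ∀ t ∈ Icc (0 : ℝ) 1, ‖A t‖ ≤ C) (y : D) :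
    Tendsto (fun t => A t (increment H l s t y)) (𝓝[Icc 0 1] s) (𝓝 0) := by
  refine tendsto_clm_apply (w₀ := 0) (eventually_mem_nhdsWithin.mono hC) (by simpa using tendsto_const_nhds) ?_
  have := h.continuousWithinAt_increment hs y
  rwa [ContinuousWithinAt, increment_self] at this

theorem continuousWithinAt_P (h : IsAdiabaticFamily H H' l P S b g) (hs : s ∈ Icc (0 : ℝ) 1)
    (x : E) : ContinuousWithinAt (fun t => P t x) (Icc 0 1) s := by
  have h1 := (h.tendsto_clm_increment hs h.norm_P ⟨S s x, (h.resolvent s hs).S_mem x⟩).neg.sub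
    (h.tendsto_clm_increment hs h.norm_S ⟨P s x, (h.resolvent s hs).P_mem x⟩)
  have h2 := h1.const_add (P s x)
  rw [neg_zero, sub_zero, add_zero] at h2
  refine Tendsto.congr' ?_ h2
  filter_upwards [self_mem_nhdsWithin] with t ht
  exact (h.P_eq hs ht x).symm

theorem continuousWithinAt_S (h : IsAdiabaticFamily H H' l P S b g) (hs : s ∈ Icc (0 : ℝ) 1)
    (x : E) : ContinuousWithinAt (fun t => S t x) (Icc 0 1) s := by
  have h0 : Tendsto (fun t => S t (S t (increment H l s t
      ⟨P s x, (h.resolvent s hs).P_mem x⟩))) (𝓝[Icc 0 1] s) (𝓝 0) :=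
    tendsto_clm_apply (w₀ := 0) (eventually_mem_nhdsWithin.mono h.norm_S) (by simpa using tendsto_const_nhds)
      (h.tendsto_clm_increment hs h.norm_S ⟨P s x, (h.resolvent s hs).P_mem x⟩)
  have h1 := ((h.tendsto_clm_increment hs h.norm_S ⟨S s x, (h.resolvent s hs).S_mem x⟩).neg.add
    h0).add (h.tendsto_clm_increment hs h.norm_P ⟨S s (S s x), (h.resolvent s hs).S_mem _⟩)
  have h2 := h1.const_add (S s x)
  rw [neg_zero, add_zero, add_zero, add_zero] at h2
  refine Tendsto.congr' ?_ h2
  filter_upwards [self_mem_nhdsWithin] with t ht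
  exact (h.S_eq hs ht x).symm

/-- The eigenvalue is differentiable. -/
theorem exists_hasDerivWithinAt_l (h : IsAdiabaticFamily H H' l P S b g)
    (hs : s ∈ Icc (0 : ℝ) 1) :
    ∃ l', HasDerivWithinAt l l' (Icc 0 1) s ∧ |l'| ≤ b := by
  obtain ⟨v, hPv, hv⟩ := h.exists_unit s hs
  have hvD : v ∈ D := hPv ▸ (h.resolvent s hs).P_mem v
  have hle : 𝓝[Icc 0 1 \ {s}] s ≤ 𝓝[Icc 0 1] s := nhdsWithin_mono _ sdiff_subset
  have hPt : Tendsto (fun t => P t v) (𝓝[Icc 0 1 \ {s}] s) (𝓝 v) := by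
    have := h.continuousWithinAt_P hs v
    rw [ContinuousWithinAt, hPv] at this
    exact this.mono_left hle
  have hq : Tendsto (fun t => (inner ℂ (P t v) v).re) (𝓝[Icc 0 1 \ {s}] s) (𝓝 1) := by
    have h1 : (inner ℂ v v).re = 1 := by rw [inner_self_eq_norm_sq_to_K, hv]; simp
    have h2 := (Complex.continuous_re.tendsto _).comp (hPt.inner (tendsto_const_nhds (x := v)) (𝕜 := ℂ))
    rwa [h1] at h2
  have hn : Tendsto (fun t => (inner ℂ (P t v) (slope (fun t => H t ⟨v, hvD⟩) s t)).re)
      (𝓝[Icc 0 1 \ {s}] s) (𝓝 (inner ℂ v (H' s v)).re) :=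
    (Complex.continuous_re.tendsto _).comp
      (hPt.inner (hasDerivWithinAt_iff_tendsto_slope.1 (h.deriv s hs ⟨v, hvD⟩)))
  refine ⟨(inner ℂ v (H' s v)).re, hasDerivWithinAt_iff_tendsto_slope.2 ?_, ?_⟩
  · have h2 := hn.div hq one_ne_zero
    rw [div_one] at h2
    refine h2.congr' ?_
    filter_upwards [hq.eventually_ne one_ne_zero, self_mem_nhdsWithin] with t hqt ht
    rw [Pi.div_apply, div_eq_iff hqt]
    have hA : H s ⟨v, hvD⟩ = (l s : ℂ) • v := by
      have := (h.resolvent s hs).A_P v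
      simpa only [hPv] using this
    -- Hellmann–Feynman: `P t` annihilates the range of `H t - l t` and `H s v = l s v`, so the
    -- difference quotient of `l` is a ratio of two convergent inner products. Only strong
    -- continuity of `P` enters.
    have h3 : inner ℂ (P t v) (increment H l s t ⟨v, hvD⟩) = 0 := by
      rw [(h.resolvent t ht.1).P_symm, h.P_increment ht.1, hA, sub_self, map_zero, neg_zero,
        inner_zero_right]
    rw [increment, inner_sub_right, inner_smul_right, sub_eq_zero] at h3
    have h4 := congrArg Complex.re h3
    rw [Complex.re_ofReal_mul] at h4
    rw [slope_def_module, slope_def_field, ← Complex.coe_smul, inner_smul_right,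
      Complex.re_ofReal_mul, h4]
    ring
  · refine (Complex.abs_re_le_norm _).trans ((norm_inner_le_norm _ _).trans ?_)
    rw [hv, one_mul]
    simpa [hv] using (H' s).le_of_opNorm_le (h.norm_deriv s hs) v

theorem hasDerivWithinAt_increment (h : IsAdiabaticFamily H H' l P S b g)
    (hs : s ∈ Icc (0 : ℝ) 1) {l' : ℝ} (hl : HasDerivWithinAt l l' (Icc 0 1) s) (y : D) :
    HasDerivWithinAt (fun t => increment H l s t y)
      ((H' s - (l' : ℂ) • (1 : E →L[ℂ] E)) y) (Icc 0 1) s := by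
  refine ((h.deriv s hs y).sub_const _).sub ?_
  exact ((hl.sub_const (l s)).ofReal_comp).smul_const (y : E)

theorem hasDerivWithinAt_P (h : IsAdiabaticFamily H H' l P S b g)
    (hs : s ∈ Icc (0 : ℝ) 1) {l' : ℝ} (hl : HasDerivWithinAt l l' (Icc 0 1) s) (x : E) :
    HasDerivWithinAt (fun t => P t x)
      (projDeriv (H' s - (l' : ℂ) • (1 : E →L[ℂ] E)) (P s) (S s) x) (Icc 0 1) s := by
  have h1 := hasDerivWithinAt_clm_apply_of_eq_zero h.norm_P (h.continuousWithinAt_P hs _)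
    (increment_self _)
    (h.hasDerivWithinAt_increment hs hl ⟨S s x, (h.resolvent s hs).S_mem x⟩)
  have h2 := hasDerivWithinAt_clm_apply_of_eq_zero h.norm_S (h.continuousWithinAt_S hs _)
    (increment_self _)
    (h.hasDerivWithinAt_increment hs hl ⟨P s x, (h.resolvent s hs).P_mem x⟩)
  exact ((h1.neg.sub h2).const_add (P s x)).congr (fun t ht => h.P_eq hs ht x) (h.P_eq hs hs x)

theorem hasDerivWithinAt_S (h : IsAdiabaticFamily H H' l P S b g)
    (hs : s ∈ Icc (0 : ℝ) 1) {l' : ℝ} (hl : HasDerivWithinAt l l' (Icc 0 1) s) (x : E) :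
    HasDerivWithinAt (fun t => S t x)
      (resolventDeriv (H' s - (l' : ℂ) • (1 : E →L[ℂ] E)) (P s) (S s) x) (Icc 0 1) s := by
  have h1 := hasDerivWithinAt_clm_apply_of_eq_zero h.norm_S (h.continuousWithinAt_S hs _)
    (increment_self _)
    (h.hasDerivWithinAt_increment hs hl ⟨S s x, (h.resolvent s hs).S_mem x⟩)
  have h2 := hasDerivWithinAt_clm_apply_of_eq_zero h.norm_S (h.continuousWithinAt_S hs _)
    (increment_self _)
    (h.hasDerivWithinAt_increment hs hl ⟨P s x, (h.resolvent s hs).P_mem x⟩)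
  have h3 := hasDerivWithinAt_clm_apply_of_eq_zero h.norm_S (h.continuousWithinAt_S hs _)
    (by rw [increment_self, map_zero]) h2
  have h4 := hasDerivWithinAt_clm_apply_of_eq_zero h.norm_P (h.continuousWithinAt_P hs _)
    (increment_self _)
    (h.hasDerivWithinAt_increment hs hl ⟨S s (S s x), (h.resolvent s hs).S_mem _⟩)
  exact (((h1.neg.add h3).add h4).const_add (S s x)).congr (fun t ht => h.S_eq hs ht x)
    (h.S_eq hs hs x)

theorem deriv_symm (h : IsAdiabaticFamily H H' l P S b g) (hs : s ∈ Icc (0 : ℝ) 1) (x y : D) :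
    inner ℂ (H' s x) (y : E) = inner ℂ (x : E) (H' s y) := by
  have h1 := (h.deriv s hs x).inner ℂ (hasDerivWithinAt_const s (Icc 0 1) (y : E))
  have h2 := (hasDerivWithinAt_const s (Icc 0 1) (x : E)).inner ℂ (h.deriv s hs y)
  have h3 := h2.congr (fun t ht => (h.resolvent t ht).symm x y) ((h.resolvent s hs).symm x y)
  have := (uniqueDiffOn_Icc_zero_one s hs).eq_deriv _ h1 h3
  simpa using this

end IsAdiabaticFamily

/-! ### Inner product identities behind the cancellation. -/

namespace IsReducedResolvent

variable {D : Submodule ℂ E} {A : D →ₗ[ℂ] E} {l g : ℝ} {P S : E →L[ℂ] E}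

theorem P_apply (h : IsReducedResolvent A l g P S) (x : D) : P (A x) = (l : ℂ) • P x := by
  have := h.P_A x
  rwa [map_sub, map_smul, sub_eq_zero] at this

theorem re_inner_P (h : IsReducedResolvent A l g P S) (x : E) :
    (inner ℂ x (P x)).re = ‖P x‖ ^ 2 := by
  rw [← h.P_P, ← h.P_symm, inner_self_eq_norm_sq_to_K, h.P_P]
  norm_cast

theorem norm_sub_P_sq (h : IsReducedResolvent A l g P S) (x : E) :
    ‖x - P x‖ ^ 2 = ‖x‖ ^ 2 - (inner ℂ x (P x)).re := by
  have := @norm_sub_sq ℂ E _ _ _ x (P x)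
  rw [this, ← h.re_inner_P]
  change _ - 2 * (inner ℂ x (P x)).re + _ = _
  ring

/-- The evolution does not change the occupation of the eigenspace. -/
theorem re_inner_P_evolution (h : IsReducedResolvent A l g P S) (τ : ℝ) (x : D) :
    (inner ℂ (x : E) (P ((-(Complex.I * (τ : ℂ))) • A x)) +
      inner ℂ ((-(Complex.I * (τ : ℂ))) • A x) (P x)).re = 0 := by
  have e : inner ℂ (A x) (P x) = (l : ℂ) * inner ℂ (x : E) (P x) := by
    rw [← h.P_P, ← h.P_symm, h.P_apply, inner_smul_left, h.P_symm, h.P_P]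
    simp
  rw [map_smul, h.P_apply, inner_smul_right, inner_smul_right, inner_smul_left, e]
  simp only [map_neg, map_mul, Complex.conj_I, Complex.conj_ofReal]
  ring_nf
  simp

/-- The two multiples of `l` cancel, and `S (A - l) = 1 - P` removes one factor `S` from `S² B P`.
This produces the `τ` that offsets the `1/τ` in `correctedOccupation`. -/
theorem im_inner_S_evolution (h : IsReducedResolvent A l g P S) (τ : ℝ) (B : E →L[ℂ] E) (x : D) :
    (inner ℂ (x : E) (S (S (B (P ((-(Complex.I * (τ : ℂ))) • A x))))) +
      inner ℂ ((-(Complex.I * (τ : ℂ))) • A x) (S (S (B (P x))))).im =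
      τ * (inner ℂ (x : E) (S (B (P x)))).re := by
  set y := S (B (P x)) with hy
  have e : inner ℂ (A x) (S y) = inner ℂ (x : E) y + (l : ℂ) * inner ℂ (x : E) (S y) := by
    have h1 : inner ℂ (A x - (l : ℂ) • (x : E)) (S y) = inner ℂ (x : E) y := by
      rw [← h.S_symm, h.S_A, inner_sub_left, h.P_symm, hy, h.P_S, inner_zero_right, sub_zero]
    rw [← h1, inner_sub_left, inner_smul_left]
    simp
  simp only [map_smul, h.P_apply]
  rw [← hy, inner_smul_right, inner_smul_right, inner_smul_left, e]
  simp only [map_neg, map_mul, Complex.conj_I, Complex.conj_ofReal]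
  ring_nf
  simp

variable {B : E →L[ℂ] E}

/-- The scalar `l'` drops out because `P S = 0`. Symmetry of `B` on `D` suffices, as both `P` and
`S` map into `D`. -/
theorem inner_perturbation (h : IsReducedResolvent A l g P S)
    (hB : ∀ x y : D, inner ℂ (B x) (y : E) = inner ℂ (x : E) (B y)) (l' : ℝ) (x z : E) :
    inner ℂ (P x) ((B - (l' : ℂ) • (1 : E →L[ℂ] E)) (S z)) = inner ℂ (S (B (P x))) z := by
  have h1 : inner ℂ (P x) (S z) = 0 := by rw [h.P_symm, h.P_S, inner_zero_right]
  have h2 := hB ⟨P x, h.P_mem x⟩ ⟨S z, h.S_mem z⟩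
  simp only at h2
  rw [sub_apply, smul_apply,
    one_apply_eq_self, inner_sub_right, inner_smul_right, h1, mul_zero, sub_zero,
    ← h2, h.S_symm]

theorem re_inner_projDeriv (h : IsReducedResolvent A l g P S)
    (hB : ∀ x y : D, inner ℂ (B x) (y : E) = inner ℂ (x : E) (B y)) (l' : ℝ) (x : E) :
    (inner ℂ x (projDeriv (B - (l' : ℂ) • (1 : E →L[ℂ] E)) P S x)).re =
      -2 * (inner ℂ x (S (B (P x)))).re := by
  have h1 : S ((B - (l' : ℂ) • (1 : E →L[ℂ] E)) (P x)) = S (B (P x)) := by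
    rw [sub_apply, smul_apply,
      one_apply_eq_self, map_sub, map_smul, h.S_P, smul_zero, sub_zero]
  have h2 : projDeriv (B - (l' : ℂ) • (1 : E →L[ℂ] E)) P S x
      = -P ((B - (l' : ℂ) • (1 : E →L[ℂ] E)) (S x)) - S (B (P x)) := by rw [← h1]; rfl
  rw [h2, inner_sub_right, inner_neg_right, ← h.P_symm, h.inner_perturbation hB,
    ← inner_conj_symm (S (B (P x))) x, Complex.sub_re, Complex.neg_re, Complex.conj_re]
  ring

/-- With `y = S B P x`, only the term `P B S S` of the derivative survives under `P`. The pairing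
becomes `⟨y, S y⟩`, which is real. -/
theorem im_inner_resolventDeriv (h : IsReducedResolvent A l g P S)
    (hB : ∀ x y : D, inner ℂ (B x) (y : E) = inner ℂ (x : E) (B y)) (l' : ℝ) (x : E) :
    (inner ℂ (P x) (resolventDeriv (B - (l' : ℂ) • (1 : E →L[ℂ] E)) P S (S (B (P x))))).im
      = 0 := by
  set y := S (B (P x)) with hy
  have h1 : P (resolventDeriv (B - (l' : ℂ) • (1 : E →L[ℂ] E)) P S y)
      = P ((B - (l' : ℂ) • (1 : E →L[ℂ] E)) (S (S y))) := by
    simp only [resolventDeriv, add_apply, neg_apply,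
      ContinuousLinearMap.comp_apply, map_add, map_neg, h.P_S, h.P_P, neg_zero, zero_add]
  rw [← h.P_P, h.P_symm, h1, ← h.P_symm, h.P_P, h.inner_perturbation hB, ← hy]
  have h2 : (starRingEnd ℂ) (inner ℂ y (S y)) = inner ℂ y (S y) := by
    rw [inner_conj_symm, h.S_symm]
  exact Complex.conj_eq_iff_im.1 h2

end IsReducedResolvent

/-! ### The adiabatic estimate. -/

variable {D : Submodule ℂ E} {H : ℝ → D →ₗ[ℂ] E} {H' H'' : ℝ → E →L[ℂ] E} {l : ℝ → ℝ}
  {P S : ℝ → E →L[ℂ] E} {b b₂ g : ℝ}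

theorem norm_sub_ofReal_smul_one_le {B : E →L[ℂ] E} (hB : ‖B‖ ≤ b) {r : ℝ} (hr : |r| ≤ b) :
    ‖B - (r : ℂ) • (1 : E →L[ℂ] E)‖ ≤ 2 * b := by
  have h1 : ‖(r : ℂ) • (1 : E →L[ℂ] E)‖ ≤ b := by
    rw [norm_smul, Complex.norm_real, Real.norm_eq_abs]
    calc |r| * ‖(1 : E →L[ℂ] E)‖ ≤ |r| * 1 := by gcongr; exact ContinuousLinearMap.norm_id_le
      _ ≤ b := by rwa [mul_one]
  linarith [norm_sub_le B ((r : ℂ) • (1 : E →L[ℂ] E))]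

/-- The occupation of the complement of the eigenspace, up to a correction of order `1 / τ`
and up to the constant `‖φ‖²`. -/
def correctedOccupation (H' P S : ℝ → E →L[ℂ] E) (τ : ℝ) (φ : ℝ → E) (t : ℝ) : ℝ :=
  -(inner ℂ (φ t) (P t (φ t))).re
    - 2 / τ * (inner ℂ (φ t) (S t (S t (H' t (P t (φ t)))))).im

theorem IsAdiabaticFamily.exists_hasDerivWithinAt_correctedOccupation
    (h : IsAdiabaticFamily H H' l P S b g)
    (hH'' : ∀ s ∈ Icc (0 : ℝ) 1, ∀ x : E, HasDerivWithinAt (fun t => H' t x) (H'' s x) (Icc 0 1) s)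
    (hb₂ : ∀ s ∈ Icc (0 : ℝ) 1, ‖H'' s‖ ≤ b₂) {τ : ℝ} (hτ : 0 < τ) {φ : ℝ → E}
    (hφD : ∀ t ∈ Icc (0 : ℝ) 1, ∃ hm : φ t ∈ D, HasDerivWithinAt φ
      ((-(Complex.I * (τ : ℂ))) • H t ⟨φ t, hm⟩) (Icc 0 1) t)
    (hφ1 : ∀ t, ‖φ t‖ = 1) {s : ℝ} (hs : s ∈ Icc (0 : ℝ) 1) :
    ∃ d, HasDerivWithinAt (correctedOccupation H' P S τ φ) d (Icc 0 1) s ∧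
      |d| ≤ 2 / τ * (‖φ s - P s (φ s)‖ * (b₂ * g ^ 2 + 16 * b ^ 2 * g ^ 3)) := by
  obtain ⟨l', hl, hl'⟩ := h.exists_hasDerivWithinAt_l hs
  obtain ⟨hm, hφ⟩ := hφD s hs
  have hR := h.resolvent s hs
  have hB := h.deriv_symm hs
  have hD := norm_sub_ofReal_smul_one_le (h.norm_deriv s hs) hl'
  have hP' := norm_projDeriv_le hD hR.norm_P hR.norm_S
  have hS' := norm_resolventDeriv_le hD hR.norm_P hR.norm_S
  set P' := projDeriv (H' s - (l' : ℂ) • (1 : E →L[ℂ] E)) (P s) (S s) with hP'def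
  set S' := resolventDeriv (H' s - (l' : ℂ) • (1 : E →L[ℂ] E)) (P s) (S s) with hS'def
  set f := φ s with hf
  set f' := (-(Complex.I * (τ : ℂ))) • H s ⟨f, hm⟩ with hf'
  have hp := hasDerivWithinAt_clm_apply h.norm_P (h.hasDerivWithinAt_P hs hl) hφ
  have hh := hasDerivWithinAt_clm_apply h.norm_deriv (hH'' s hs) hp
  have hy := hasDerivWithinAt_clm_apply h.norm_S (h.hasDerivWithinAt_S hs hl) hh
  have hq := hasDerivWithinAt_clm_apply h.norm_S (h.hasDerivWithinAt_S hs hl) hy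
  rw [← hP'def, ← hf] at hp hh hy hq
  rw [← hS'def] at hy hq
  set w := S' (S s (H' s (P s f))) + (S s (S' (H' s (P s f)))
    + (S s (S s (H'' s (P s f))) + S s (S s (H' s (P' f))))) with hw
  have ew : S' (S s (H' s (P s f))) + S s (S' (H' s (P s f)) + S s (H'' s (P s f) +
      H' s (P' f + P s f'))) = w + S s (S s (H' s (P s f'))) := by
    simp only [map_add, hw]; abel
  rw [ew] at hq
  have h1 := Complex.reCLM.hasFDerivAt.comp_hasDerivWithinAt s (hφ.inner ℂ hp)
  have h2 := Complex.imCLM.hasFDerivAt.comp_hasDerivWithinAt s (hφ.inner ℂ hq)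
  have h3 := h1.neg.sub (h2.const_mul (2 / τ))
  rw [← hf] at h3
  simp only [Complex.reCLM_apply, Complex.imCLM_apply] at h3
  refine ⟨_, h3, ?_⟩
  have e1 : (inner ℂ f (P' f + P s f') + inner ℂ f' (P s f)).re
      = -2 * (inner ℂ f (S s (H' s (P s f)))).re := by
    rw [inner_add_right, add_assoc, Complex.add_re, hR.re_inner_P_evolution τ ⟨f, hm⟩, add_zero]
    exact hR.re_inner_projDeriv hB l' f
  have e2 : (inner ℂ f (w + S s (S s (H' s (P s f')))) +
      inner ℂ f' (S s (S s (H' s (P s f))))).im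
      = (inner ℂ f w).im + τ * (inner ℂ f (S s (H' s (P s f)))).re := by
    rw [inner_add_right, add_assoc, Complex.add_im]
    exact congrArg _ (hR.im_inner_S_evolution τ (H' s) ⟨f, hm⟩)
  -- Replacing `f` by `f - P f` supplies the factor `‖Qφ‖`. Three summands of `w` lie in the range
  -- of `S`, orthogonal to `P f`; the fourth pairs to a real number.
  have e3 : (inner ℂ f w).im = (inner ℂ (f - P s f) w).im := by
    have e4 : (inner ℂ (P s f) w).im = 0 := by
      have e5 : ∀ z, inner ℂ (P s f) (S s z) = 0 := fun z => by
        rw [hR.P_symm, hR.P_S, inner_zero_right]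
      rw [hw, inner_add_right, inner_add_right, inner_add_right, e5, e5, e5, add_zero, add_zero,
        add_zero]
      exact hR.im_inner_resolventDeriv hB l' f
    rw [inner_sub_left, Complex.sub_im, e4, sub_zero]
  rw [e1, e2, e3]
  have e6 : -(-2 * (inner ℂ f (S s (H' s (P s f)))).re) - 2 / τ *
      ((inner ℂ (f - P s f) w).im + τ * (inner ℂ f (S s (H' s (P s f)))).re)
      = -(2 / τ * (inner ℂ (f - P s f) w).im) := by
    field_simp; ring
  rw [e6, abs_neg, abs_mul, abs_of_pos (by positivity : 0 < 2 / τ)]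
  have hb := (norm_nonneg _).trans (h.norm_deriv s hs)
  have hg := (norm_nonneg _).trans (h.norm_S s hs)
  have hb₂' := (norm_nonneg _).trans (hb₂ s hs)
  have n0 : ‖P s f‖ ≤ 1 := by simpa [hφ1, hf] using (P s).le_of_opNorm_le hR.norm_P f
  have nP' : ‖P' f‖ ≤ 2 * (2 * b) * g := by simpa [hφ1, hf] using P'.le_of_opNorm_le hP' f
  have nS : ∀ {z : E} {c : ℝ}, ‖z‖ ≤ c → ‖S s z‖ ≤ g * c := fun hz =>
    (S s).le_of_opNorm_le_of_le hR.norm_S hz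
  have n1 : ‖H' s (P s f)‖ ≤ b * 1 := (H' s).le_of_opNorm_le_of_le (h.norm_deriv s hs) n0
  have m1 := S'.le_of_opNorm_le_of_le hS' (nS n1)
  have m2 := nS (S'.le_of_opNorm_le_of_le hS' n1)
  have m3 := nS (nS ((H'' s).le_of_opNorm_le_of_le (hb₂ s hs) n0))
  have m4 := nS (nS ((H' s).le_of_opNorm_le_of_le (h.norm_deriv s hs) nP'))
  -- As `‖H' - l'‖ ≤ 2b`, one has `‖S'‖ ≤ 6bg²` and `‖P' f‖ ≤ 4bg`. The two terms with `S'` give `6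
  -- + 6` and the one with `P'` gives `4`, hence `16 b² g³`.
  have nw : ‖w‖ ≤ b₂ * g ^ 2 + 16 * b ^ 2 * g ^ 3 := by
    refine (norm_add_le_of_le m1 (norm_add_le_of_le m2 (norm_add_le_of_le m3 m4))).trans
      (le_of_eq ?_)
    ring
  gcongr
  refine (Complex.abs_im_le_norm _).trans ((norm_inner_le_norm _ _).trans ?_)
  gcongr

/-- **Adiabatic theorem** for an initial state in the eigenspace. -/
theorem IsAdiabaticFamily.norm_sub_le (h : IsAdiabaticFamily H H' l P S b g)
    (hH'' : ∀ s ∈ Icc (0 : ℝ) 1, ∀ x : E, HasDerivWithinAt (fun t => H' t x) (H'' s x) (Icc 0 1) s)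
    (hb₂ : ∀ s ∈ Icc (0 : ℝ) 1, ‖H'' s‖ ≤ b₂) {τ : ℝ} (hτ : 0 < τ) {φ : ℝ → E}
    (hφD : ∀ t ∈ Icc (0 : ℝ) 1, ∃ hm : φ t ∈ D, HasDerivWithinAt φ
      ((-(Complex.I * (τ : ℂ))) • H t ⟨φ t, hm⟩) (Icc 0 1) t)
    (hφ1 : ∀ t, ‖φ t‖ = 1) (hφ0 : P 0 (φ 0) = φ 0) {s : ℝ} (hs : s ∈ Icc (0 : ℝ) 1) :
    ‖φ s - P s (φ s)‖ ≤ 2 / τ * (b * g ^ 2 + s * (b₂ * g ^ 2 + 16 * b ^ 2 * g ^ 3)) := by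
  set W := b₂ * g ^ 2 + 16 * b ^ 2 * g ^ 3 with hW
  have h0 : (0 : ℝ) ∈ Icc (0 : ℝ) 1 := by simp
  have hb := (norm_nonneg _).trans (h.norm_deriv s hs)
  have hg := (norm_nonneg _).trans (h.norm_S s hs)
  have hb₂' := (norm_nonneg _).trans (hb₂ s hs)
  have hW0 : 0 ≤ W := by positivity
  have hcont : ContinuousOn (fun t => ‖φ t - P t (φ t)‖) (Icc 0 s) := fun t ht => by
    have ht' : t ∈ Icc (0 : ℝ) 1 := ⟨ht.1, ht.2.trans hs.2⟩
    obtain ⟨l', hl, -⟩ := h.exists_hasDerivWithinAt_l ht'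
    obtain ⟨hm, hφ⟩ := hφD t ht'
    exact ((hφ.sub (hasDerivWithinAt_clm_apply h.norm_P (h.hasDerivWithinAt_P ht' hl)
      hφ)).continuousWithinAt.norm).mono (Icc_subset_Icc_right hs.2)
  -- At a maximum point `u` of the leakage, both the integrated remainder and the boundary term are
  -- linear in `G`, so one factor `G` can be divided out.
  obtain ⟨u, hu, hmax⟩ := isCompact_Icc.exists_isMaxOn ⟨0, by simpa using hs.1⟩ hcont
  have hu' : u ∈ Icc (0 : ℝ) 1 := ⟨hu.1, hu.2.trans hs.2⟩
  set G := ‖φ u - P u (φ u)‖ with hG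
  have hGs : ‖φ s - P s (φ s)‖ ≤ G := hmax ⟨hs.1, le_rfl⟩
  have hsub : Icc (0 : ℝ) u ⊆ Icc 0 1 := Icc_subset_Icc_right hu'.2
  choose! d hd hd' using fun t (ht : t ∈ Icc (0 : ℝ) 1) =>
    h.exists_hasDerivWithinAt_correctedOccupation hH'' hb₂ hτ hφD hφ1 ht
  have hmv := (convex_Icc (0 : ℝ) u).norm_image_sub_le_of_norm_hasDerivWithin_le
    (f := correctedOccupation H' P S τ φ) (C := 2 / τ * (G * W))
    (fun t ht => (hd t (hsub ht)).mono hsub)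
    (fun t ht => (hd' t (hsub ht)).trans (by
      gcongr
      exact hmax ⟨ht.1, ht.2.trans hu.2⟩))
    (left_mem_Icc.2 hu.1) (right_mem_Icc.2 hu.1)
  have hM : ∀ t ∈ Icc (0 : ℝ) 1, |(inner ℂ (φ t) (S t (S t (H' t (P t (φ t)))))).im|
      ≤ ‖φ t - P t (φ t)‖ * (b * g ^ 2) := fun t ht => by
    have hR := h.resolvent t ht
    have e : inner ℂ (φ t) (S t (S t (H' t (P t (φ t)))))
        = inner ℂ (φ t - P t (φ t)) (S t (S t (H' t (P t (φ t))))) := by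
      rw [inner_sub_left, hR.P_symm, hR.P_S, inner_zero_right, sub_zero]
    rw [e]
    refine (Complex.abs_im_le_norm _).trans ((norm_inner_le_norm _ _).trans ?_)
    have n0 : ‖P t (φ t)‖ ≤ 1 := by simpa [hφ1] using (P t).le_of_opNorm_le hR.norm_P (φ t)
    have n1 := (S t).le_of_opNorm_le_of_le hR.norm_S ((S t).le_of_opNorm_le_of_le hR.norm_S
      ((H' t).le_of_opNorm_le_of_le (h.norm_deriv t ht) n0))
    gcongr
    exact n1.trans (le_of_eq (by ring))
  -- The correction vanishes at time `0` because it is bounded by `‖Qφ(0)‖ = 0`; only the boundary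
  -- term at `u` remains.
  have hF0 : correctedOccupation H' P S τ φ 0 = -1 := by
    have h1 := hM 0 h0
    rw [hφ0, sub_self, norm_zero, zero_mul] at h1
    have h2 := abs_nonpos_iff.1 h1
    have h3 := (h.resolvent 0 h0).re_inner_P (φ 0)
    rw [hφ0, hφ1, one_pow] at h3
    rw [correctedOccupation, hφ0, h2, h3]
    ring
  have hFu : G ^ 2 = 1 + correctedOccupation H' P S τ φ u
      + 2 / τ * (inner ℂ (φ u) (S u (S u (H' u (P u (φ u)))))).im := by
    rw [hG, (h.resolvent u hu').norm_sub_P_sq, hφ1, correctedOccupation]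
    ring
  rw [hF0, sub_neg_eq_add, sub_zero, Real.norm_eq_abs, Real.norm_eq_abs, abs_of_nonneg hu.1] at hmv
  have hτ' : 0 < 2 / τ := by positivity
  have hG0 : 0 ≤ G := norm_nonneg _
  have h1 : G * G ≤ G * (2 / τ * (b * g ^ 2 + s * W)) := by
    calc G * G = G ^ 2 := by ring
      _ ≤ 2 / τ * (G * W) * u + 2 / τ * (G * (b * g ^ 2)) := by
        rw [hFu]
        have a1 := (le_abs_self _).trans hmv
        have a2 := mul_le_mul_of_nonneg_left ((le_abs_self _).trans (hM u hu')) hτ'.le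
        linarith
      _ ≤ 2 / τ * (G * W) * s + 2 / τ * (G * (b * g ^ 2)) := by gcongr; exact hu.2
      _ = _ := by ring
  refine hGs.trans ?_
  rcases hG0.eq_or_lt with hz | hz
  · rw [← hz]
    have := hs.1
    positivity
  · exact le_of_mul_le_mul_left h1 hz

/-! ### Ground states of a gapped Hamiltonian and the perturbed initial state. -/

theorem projQ_apply (v x : E) : projQ v x = x - projP v x := rfl

theorem norm_projQ_le (v : E) : ‖projQ v‖ ≤ 1 := by
  have : projQ v = (Submodule.span ℂ {v})ᗮ.starProjection := by
    ext x
    rw [Submodule.starProjection_orthogonal_val]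
    rfl
  rw [this]
  exact Submodule.starProjection_norm_le _

/-- The ground states of a gapped Hamiltonian form an adiabatic family. -/
theorem exists_isAdiabaticFamily [CompleteSpace E] {N : ℕ∞} (hN : 1 < N) {D : Submodule ℂ E}
    {H : ℝ → D →ₗ[ℂ] E} {H' H'' : ℝ → E →L[ℂ] E} (hH : IsTwiceDiffHamiltonian H H' H'')
    {ψ : ℝ → HilbertBasis (Level N) ℂ E} {lam : ℝ → Level N → ℝ}
    (hψ : ∀ s ∈ Icc (0 : ℝ) 1, IsOrderedEigenbasis (H s) (ψ s) (lam s)) {b γ : ℝ}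
    (hb : ∀ s ∈ Icc (0 : ℝ) 1, ‖H' s‖ ≤ b) (hγ_pos : 0 < γ)
    (hγ : ∀ s ∈ Icc (0 : ℝ) 1, γ ≤ lam s (level1 hN) - lam s (level0 hN)) :
    ∃ S : ℝ → E →L[ℂ] E, IsAdiabaticFamily H H' (fun s => lam s (level0 hN))
      (fun s => projP (ψ s (level0 hN))) S b γ⁻¹ := by
  choose! S hS using fun s (hs : s ∈ Icc (0 : ℝ) 1) =>
    exists_isReducedResolvent hN (hH.selfAdjoint s hs) (hψ s hs) hγ_pos (hγ s hs)
  -- Variational principle: the ground state `v` at time `s` is a trial vector at time `t`, so `l t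
  -- - l s ≤ ⟨v, (H t - H s) v⟩`. Exchanging `s` and `t` gives the Lipschitz bound.
  have hle : ∀ s ∈ Icc (0 : ℝ) 1, ∀ t ∈ Icc (0 : ℝ) 1,
      lam t (level0 hN) - lam s (level0 hN) ≤ b * |t - s| := fun s hs t ht => by
    obtain ⟨hD, hA⟩ := (hψ s hs).eigen (level0 hN)
    have hv := (ψ s).orthonormal.1 (level0 hN)
    set v := ψ s (level0 hN)
    have h1 := (hψ t ht).mul_norm_sq_le_re_inner hN (hS t ht).symm ⟨v, hD⟩
    have h2 : ‖H t ⟨v, hD⟩ - H s ⟨v, hD⟩‖ ≤ b * ‖t - s‖ :=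
      (convex_Icc (0 : ℝ) 1).norm_image_sub_le_of_norm_hasDerivWithin_le
        (fun r hr => hH.deriv_one r hr ⟨v, hD⟩)
        (fun r hr => by simpa [hv] using (H' r).le_of_opNorm_le (hb r hr) v) hs ht
    have h3 : (inner ℂ v (H t ⟨v, hD⟩ - H s ⟨v, hD⟩)).re ≤ b * |t - s| := by
      refine (Complex.re_le_norm _).trans ((norm_inner_le_norm _ _).trans ?_)
      rwa [hv, one_mul]
    have h4 : (inner ℂ v (H s ⟨v, hD⟩)).re = lam s (level0 hN) := by
      rw [hA, inner_smul_right, inner_self_eq_norm_sq_to_K, hv]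
      simp
    simp only [hv, one_pow, mul_one] at h1
    rw [inner_sub_right, Complex.sub_re, h4] at h3
    linarith
  refine ⟨S, hS, hH.deriv_one, hb, fun s hs t ht => abs_sub_le_iff.2 ⟨hle s hs t ht, ?_⟩,
    fun s hs => ⟨ψ s (level0 hN), ?_, (ψ s).orthonormal.1 _⟩⟩
  · rw [abs_sub_comm]
    exact hle t ht s hs
  · exact Submodule.starProjection_eq_self_iff.2 (Submodule.mem_span_singleton_self _)

end Adiabatic

end

open Adiabatic in
theorem mainTheorem6
    {E : Type*} [NormedAddCommGroup E] [InnerProductSpace ℂ E] [CompleteSpace E]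
    {N : ℕ∞} (hN : 1 < N)
    {D : Submodule ℂ E} (H : ℝ → D →ₗ[ℂ] E) (H' H'' : ℝ → E →L[ℂ] E)
    (hH : IsTwiceDiffHamiltonian H H' H'')
    (ψ : ℝ → HilbertBasis (Level N) ℂ E) (lam : ℝ → Level N → ℝ)
    (hψ : ∀ s ∈ Set.Icc (0 : ℝ) 1, IsOrderedEigenbasis (H s) (ψ s) (lam s))
    (b₁ b₂ γ : ℝ)
    (hb₁ : ∀ s ∈ Set.Icc (0 : ℝ) 1, ‖H' s‖ ≤ b₁)
    (hb₂ : ∀ s ∈ Set.Icc (0 : ℝ) 1, ‖H'' s‖ ≤ b₂)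
    (hγ_pos : 0 < γ)
    (hγ : ∀ s ∈ Set.Icc (0 : ℝ) 1, γ ≤ lam s (level1 hN) - lam s (level0 hN))
    (τ : ℝ) (hτ : 0 < τ)
    (U : ℝ → E ≃ₗᵢ[ℂ] E) (hU : IsEvolution H τ U)
    (η δ : ℂ) (φperp : E)
    (hη : ‖η‖ ^ (-2 : ℤ) = 1 + ‖δ‖ ^ 2)
    (hφ_norm : ‖φperp‖ = 1)
    (hφ_orth : inner ℂ (ψ 0 (level0 hN)) φperp = 0)
    (s : ℝ) (hs : s ∈ Set.Icc (0 : ℝ) 1) :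
    ‖projQ (ψ s (level0 hN)) (U s (perturbedState η δ (ψ 0 (level0 hN)) φperp))‖ ≤
      ‖η‖ * (‖δ‖ + 8 / (τ * γ ^ 2) * (2 * b₁ + s * b₂ + s * (16 * b₁ ^ 2 / γ))) := by
  obtain ⟨S, hS⟩ := exists_isAdiabaticFamily hN hH hψ hb₁ hγ_pos hγ
  have h0 : (0 : ℝ) ∈ Set.Icc (0 : ℝ) 1 := by simp
  set v := ψ 0 (level0 hN)
  obtain ⟨hvD, -⟩ := (hψ 0 h0).eigen (level0 hN)
  have hmain := hS.norm_sub_le hH.deriv_two hb₂ hτ (φ := fun t => U t v)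
    (fun t ht => hU.schrodinger t ht ⟨v, hvD⟩)
    (fun t => by rw [LinearIsometryEquiv.norm_map]; exact (ψ 0).orthonormal.1 _)
    (by
      simp only [hU.initial]
      exact Submodule.starProjection_eq_self_iff.2 (Submodule.mem_span_singleton_self _)) hs
  have hb₁' := (norm_nonneg _).trans (hb₁ s hs)
  have hb₂' := (norm_nonneg _).trans (hb₂ s hs)
  have hground : ‖projQ (ψ s (level0 hN)) (U s v)‖
      ≤ 8 / (τ * γ ^ 2) * (2 * b₁ + s * b₂ + s * (16 * b₁ ^ 2 / γ)) := by
    rw [projQ_apply]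
    refine hmain.trans ?_
    -- The estimate obtained is sharper than required: it has `2` in place of `8` and `b₁` in place
    -- of `2 * b₁`.
    have e : 2 / τ * (b₁ * γ⁻¹ ^ 2 + s * (b₂ * γ⁻¹ ^ 2 + 16 * b₁ ^ 2 * γ⁻¹ ^ 3))
        = 2 / (τ * γ ^ 2) * (b₁ + s * b₂ + s * (16 * b₁ ^ 2 / γ)) := by
      field_simp
      ring
    rw [e]
    have hs0 := hs.1
    gcongr
    · norm_num
    · linarith
  have hperp : ‖projQ (ψ s (level0 hN)) (U s φperp)‖ ≤ 1 := by
    have := (projQ (ψ s (level0 hN))).le_of_opNorm_le (norm_projQ_le _) (U s φperp)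
    rwa [LinearIsometryEquiv.norm_map, hφ_norm, mul_one] at this
  rw [perturbedState, map_smul, map_smul, norm_smul, map_add, map_add, map_smul, map_smul]
  gcongr
  refine (norm_add_le _ _).trans ?_
  rw [norm_smul, add_comm]
  gcongr
  exact mul_le_of_le_one_right (norm_nonneg _) hperp
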